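/- Let $\mathfrak A$ be a $C^*$-algebra (not necessarily unital), let $H$ be a Hilbert $\mathfrak A$-module, that is, an $\mathfrak A$-module with an $\mathfrak A$-valued inner product $\langle\cdot,\cdot\rangle$, linear in the second variable, such that $H$ is complete in the norm $\|x\|=\|\langle x,x\rangle\|^{1/2}$, and let $\mathcal L(H)$ be the algebra, with the operator norm, of all adjointable operators on $H$, i.e. of all maps $T:H\to H$ for which there is a map $T^*:H\to H$ with $\langle Tx,y\rangle=\langle x,T^*y\rangle$ for all $x,y\in H$. (Left and right modules are interchangeable here, since a right $\mathfrak A$-module is a left module over the opposite $C^*$-algebra.) For $T\in\mathcal L(H)$ let $$w(T)=\sup\{\|\langle Tx,x\rangle\| : x\in H,\ \|x\|=1\}$$ be its numerical radius (with $w(T)=0$ if $H=0$), and let $r(T)$ be its spectral radius in $\mathcal L(H)$, i.e. $r(T)=\sup\{|\lambda|:\lambda\in\mathbb C,\ T-\lambda \text{ is not invertible in } \mathcal L(H)\}$ (with $r(T)=0$ if $H=0$). Then for all $A_1,A_2,B_1,B_2\in\mathcal L(H)$, $$r(A_1B_1+A_2B_2)\le\frac12\Big(w(B_1A_1)+w(B_2A_2)+\sqrt{\alpha}\Big),$$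 where $$\alpha=\big[w(B_1A_1)-w(B_2A_2)\big]^2+4\,\|B_1A_2\|\cdot\|B_2A_1\|.$$ -/

import Mathlib

/-! Throughout, a Hilbert module over a C⋆-algebra `A` is Mathlib's `CStarModule A H` on a complete
normed space `H`: the inner product `inner A x y` is `A`-valued, linear in the second variable and
`‖x‖ = √‖inner A x x‖`. Its `A`-action is written on the left; right Hilbert `A`-modules are the
same thing over the opposite C⋆-algebra, with the same operators, norms and adjoints. -/

section HilbertCStarModule

/-- `L(H)`: the algebra of adjointable operators on `H`, i.e. of all `T : H → H` for which there is
a map `S : H → H` with `⟨T x, y⟩ = ⟨x, S y⟩` for all `x`, `y`. Such maps are automatically linear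
and bounded (see `exists_mem_adjointableOperators`), so that the algebra is realised inside the
bounded operators. Its norm is the operator norm. -/
def adjointableOperators (A H : Type*) [NonUnitalCStarAlgebra A] [PartialOrder A]
    [StarOrderedRing A] [NormedAddCommGroup H] [NormedSpace ℂ H] [SMul A H] [CStarModule A H] :
    Subalgebra ℂ (H →L[ℂ] H) where
  carrier := {T | ∃ S : H → H, ∀ x y : H, inner A (T x) y = inner A x (S y)}
  mul_mem' := by
    rintro T₁ T₂ ⟨S₁, h₁⟩ ⟨S₂, h₂⟩
    exact ⟨fun y => S₂ (S₁ y), fun x y => by simp [h₁, h₂]⟩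
  add_mem' := by
    rintro T₁ T₂ ⟨S₁, h₁⟩ ⟨S₂, h₂⟩
    exact ⟨fun y => S₁ y + S₂ y, fun x y => by simp [h₁, h₂]⟩
  algebraMap_mem' := fun c =>
    ⟨fun y => star c • y, fun x y => by simp [Algebra.algebraMap_eq_smul_one]⟩

/-- Every adjointable map is (the underlying map of) an element of `adjointableOperators A H`:
linearity and boundedness need not be assumed. -/
theorem exists_mem_adjointableOperators {A H : Type*} [NonUnitalCStarAlgebra A] [PartialOrder A]
    [StarOrderedRing A] [NormedAddCommGroup H] [NormedSpace ℂ H] [CompleteSpace H] [SMul A H]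
    [CStarModule A H] (T S : H → H) (hTS : ∀ x y : H, inner A (T x) y = inner A x (S y)) :
    ∃ T' ∈ adjointableOperators A H, ∀ x, T' x = T x := by
  have key : ∀ u v : H, (∀ y, inner A u y = inner A v y) → u = v := by
    intro u v h
    rw [← sub_eq_zero, ← CStarModule.inner_self (A := A), CStarModule.inner_sub_left, h, sub_self]
  let L : H →ₗ[ℂ] H :=
    { toFun := T
      map_add' := fun x y => key _ _ fun z => by simp [hTS]
      map_smul' := fun c x => key _ _ fun z => by simp [hTS] }
  have hL : ∀ x, L x = T x := fun _ => rfl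
  refine ⟨ContinuousLinearMap.ofSeqClosedGraph (g := L) ?_, ⟨S, fun x y => hTS x y⟩, fun _ => rfl⟩
  intro u x y hu hTu
  refine key _ _ fun z => ?_
  have cont : Continuous fun w : H => inner A w z :=
    (CStarModule.continuous_inner (A := A) (E := H)).comp (continuous_id.prodMk continuous_const)
  have h₁ := (cont.tendsto y).comp hTu
  have h₂ : Filter.Tendsto (fun n => inner A (L (u n)) z) Filter.atTop
      (nhds (inner A (L x) z)) := by
    simp only [hL, hTS]
    exact (((CStarModule.continuous_inner (A := A) (E := H)).comp
      (continuous_id.prodMk continuous_const)).tendsto x).comp hu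
  exact tendsto_nhds_unique h₁ h₂

/-- The numerical radius `w(T) = sup {‖⟨T x, x⟩‖ : ‖x‖ = 1}` of an adjointable operator. The set is
bounded above by `‖T‖`; for `H = 0` it is empty and `w(T) = 0`. -/
noncomputable def numericalRadius {A H : Type*} [NonUnitalCStarAlgebra A] [PartialOrder A]
    [StarOrderedRing A] [NormedAddCommGroup H] [NormedSpace ℂ H] [SMul A H] [CStarModule A H]
    (T : adjointableOperators A H) : ℝ :=
  sSup {r : ℝ | ∃ x : H, ‖x‖ = 1 ∧ r = ‖(inner A ((T : H →L[ℂ] H) x) x : A)‖}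

/-- The supremum in the definition of the numerical radius is a genuine one. -/
theorem bddAbove_numericalRadius {A H : Type*} [NonUnitalCStarAlgebra A] [PartialOrder A]
    [StarOrderedRing A] [NormedAddCommGroup H] [NormedSpace ℂ H] [SMul A H] [CStarModule A H]
    (T : adjointableOperators A H) :
    BddAbove {r : ℝ | ∃ x : H, ‖x‖ = 1 ∧ r = ‖(inner A ((T : H →L[ℂ] H) x) x : A)‖} := by
  refine ⟨‖T‖, ?_⟩
  rintro r ⟨x, hx, rfl⟩
  have h₁ := CStarModule.norm_inner_le (A := A) H (x := (T : H →L[ℂ] H) x) (y := x)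
  have h₂ := (T : H →L[ℂ] H).le_opNorm x
  rw [hx, mul_one] at h₁ h₂
  exact h₁.trans h₂

end HilbertCStarModule

/-!
A point `μ` of largest modulus in the spectrum of `T = A₁B₁ + A₂B₂` lies on its boundary, so `T - μ`
is not bounded below: otherwise the inverses of `T - ν`, for `ν` just outside the spectrum, would
stay bounded as `ν → μ`, and `T - μ` would be invertible
(`mem_resolventSet_of_forall_mul_norm_le`; this needs `L(H)` to be complete).

On the other hand `T x ≈ μ x` forces `y₁ = B₁ x` and `y₂ = B₂ x` to satisfy
`B₁A₁ y₁ + B₁A₂ y₂ ≈ μ y₁` and `B₂A₁ y₁ + B₂A₂ y₂ ≈ μ y₂`. Pairing with `y₁` and `y₂` gives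
`(|μ| - w(B₁A₁)) ‖y₁‖ ≲ ‖B₁A₂‖ ‖y₂‖` and `(|μ| - w(B₂A₂)) ‖y₂‖ ≲ ‖B₂A₁‖ ‖y₁‖`. If `|μ|` exceeds
the claimed bound, which is the larger root of
`(s - w(B₁A₁)) (s - w(B₂A₂)) = ‖B₁A₂‖ ‖B₂A₁‖`, then `y₁ ≈ 0` and `y₂ ≈ 0`, hence
`μ x ≈ A₁ y₁ + A₂ y₂ ≈ 0`. So `T - μ` is bounded below
(`exists_pos_forall_mul_norm_le`), a contradiction. Working with the vectors `y₁`, `y₂` separately,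
rather than with the operator matrix on `H ⊕ H`, avoids comparing the norm of `H ⊕ H` with the
norms of the components.
-/

section HilbertCStarModule

variable {A H : Type*} [NonUnitalCStarAlgebra A] [PartialOrder A]
    [StarOrderedRing A] [NormedAddCommGroup H] [NormedSpace ℂ H] [SMul A H] [CStarModule A H]

/-! ### Completeness of the algebra of adjointable operators -/

theorem norm_le_of_inner_eq_inner {T : H →L[ℂ] H} {S : H → H}
    (h : ∀ x y : H, inner A (T x) y = inner A x (S y)) (y : H) : ‖S y‖ ≤ ‖T‖ * ‖y‖ := by
  have h₁ : ‖S y‖ ^ 2 ≤ ‖T (S y)‖ * ‖y‖ := by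
    rw [CStarModule.norm_sq_eq A, ← h]
    exact CStarModule.norm_inner_le (A := A) H
  have h₂ := T.le_opNorm (S y)
  rcases (norm_nonneg (S y)).eq_or_lt with h₀ | h₀
  · rw [← h₀]; positivity
  · refine le_of_mul_le_mul_right ?_ h₀
    nlinarith [norm_nonneg y]

/-- The adjoints of a convergent sequence of adjointable operators converge pointwise, because
passing to the adjoint does not increase distances. -/
theorem isClosed_adjointableOperators [CompleteSpace H] :
    IsClosed (adjointableOperators A H : Set (H →L[ℂ] H)) := by
  refine isClosed_of_closure_subset fun T hT => ?_
  obtain ⟨u, hu, hlim⟩ := mem_closure_iff_seq_limit.1 hT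
  choose S hS using hu
  have hcauchy : ∀ y, CauchySeq fun n => S n y := fun y => by
    have hle : ∀ m n, ‖S m y - S n y‖ ≤ ‖u m - u n‖ * ‖y‖ := fun m n =>
      norm_le_of_inner_eq_inner (A := A) (T := u m - u n) (S := fun z => S m z - S n z)
        (fun x z => by simp [hS]) y
    rw [Metric.cauchySeq_iff]
    intro ε hε
    obtain ⟨N, hN⟩ := Metric.cauchySeq_iff.1 hlim.cauchySeq (ε / (‖y‖ + 1)) (by positivity)
    refine ⟨N, fun m hm n hn => ?_⟩
    have h₁ := hN m hm n hn
    rw [dist_eq_norm, lt_div_iff₀ (by positivity)] at h₁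
    rw [dist_eq_norm]
    nlinarith [hle m n, norm_nonneg (u m - u n)]
  choose R hR using fun y => cauchySeq_tendsto_of_complete (hcauchy y)
  refine ⟨R, fun x y => ?_⟩
  have hTx : Filter.Tendsto (fun n => u n x) Filter.atTop (nhds (T x)) :=
    ((ContinuousLinearMap.apply ℂ H x).continuous.tendsto T).comp hlim
  have h₁ : Filter.Tendsto (fun n => (inner A (u n x) y : A)) Filter.atTop
      (nhds (inner A (T x) y)) :=
    ((CStarModule.continuous_inner (A := A) (E := H)).tendsto (T x, y)).comp
      (hTx.prodMk_nhds tendsto_const_nhds)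
  have h₂ : Filter.Tendsto (fun n => (inner A x (S n y) : A)) Filter.atTop
      (nhds (inner A x (R y))) :=
    ((CStarModule.continuous_inner (A := A) (E := H)).tendsto (x, R y)).comp
      (tendsto_const_nhds.prodMk_nhds (hR y))
  simp only [hS] at h₁
  exact tendsto_nhds_unique h₁ h₂

instance [CompleteSpace H] : CompleteSpace (adjointableOperators A H) :=
  isClosed_adjointableOperators.completeSpace_coe

/-! ### Spectral values of maximal modulus -/

/-- A nonzero number `μ` dominating the spectrum of `T` in modulus, for which `T - μ` is bounded
below, is not a spectral value. -/
theorem mem_resolventSet_of_forall_mul_norm_le [CompleteSpace H] {T : adjointableOperators A H}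
    {μ : ℂ} (hμ : μ ≠ 0) (hmax : ∀ ν ∈ spectrum ℂ T, ‖ν‖ ≤ ‖μ‖) {c : ℝ} (hc : 0 < c)
    (hT : ∀ x : H, c * ‖x‖ ≤ ‖(T : H →L[ℂ] H) x - μ • x‖) : μ ∈ resolventSet ℂ T := by
  have hμ' : 0 < ‖μ‖ := norm_pos_iff.2 hμ
  -- `ν = (1 + t) μ` lies outside the spectrum, at distance `c / 3` from `μ`.
  set t : ℝ := c / (3 * ‖μ‖) with ht
  have ht₀ : 0 < t := by positivity
  have htμ : t * ‖μ‖ = c / 3 := by rw [ht]; field_simp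
  set ν : ℂ := μ + t * μ with hν
  have hdist : ‖(t : ℂ) * μ‖ = c / 3 := by
    rw [norm_mul, Complex.norm_real, Real.norm_of_nonneg ht₀.le, htμ]
  have hνn : ‖μ‖ < ‖ν‖ := by
    have : ν = ((1 + t : ℝ) : ℂ) * μ := by rw [hν]; push_cast; ring
    rw [this, norm_mul, Complex.norm_real, Real.norm_of_nonneg (by positivity)]
    nlinarith
  obtain ⟨U, hU⟩ : IsUnit (algebraMap ℂ (adjointableOperators A H) ν - T) :=
    spectrum.notMem_iff.1 fun h => (hmax ν h).not_gt hνn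
  set V : adjointableOperators A H := ↑U⁻¹ with hV
  have hUV : ∀ y : H, ν • (V : H →L[ℂ] H) y - (T : H →L[ℂ] H) ((V : H →L[ℂ] H) y) = y := by
    intro y
    have h : (algebraMap ℂ (adjointableOperators A H) ν - T) * V = 1 := by
      rw [← hU, hV, Units.mul_inv]
    simpa [Algebra.algebraMap_eq_smul_one] using
      congrArg (fun S : adjointableOperators A H => (S : H →L[ℂ] H) y) h
  have hVn : ‖V‖ ≤ 3 / (2 * c) := by
    refine ContinuousLinearMap.opNorm_le_bound (V : H →L[ℂ] H) (by positivity) fun y => ?_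
    set z := (V : H →L[ℂ] H) y with hz
    have h₁ : (T : H →L[ℂ] H) z - μ • z = ((t : ℂ) * μ) • z - y := by
      rw [← hUV y, ← hz, hν, add_smul]; abel
    have h₂ := hT z
    have h₃ := norm_sub_le (((t : ℂ) * μ) • z) y
    rw [norm_smul, hdist] at h₃
    rw [h₁] at h₂
    rw [div_mul_eq_mul_div, le_div_iff₀ (by positivity)]
    nlinarith
  have hlt : ‖((t : ℂ) * μ) • V‖ < 1 := by
    change ‖((t : ℂ) * μ) • (V : H →L[ℂ] H)‖ < 1
    rw [norm_smul, hdist]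
    calc c / 3 * ‖(V : H →L[ℂ] H)‖ ≤ c / 3 * (3 / (2 * c)) := by gcongr; exact hVn
      _ = 1 / 2 := by field_simp
      _ < 1 := by norm_num
  have hfac : algebraMap ℂ (adjointableOperators A H) μ - T =
      U * (1 - ((t : ℂ) * μ) • V) := by
    rw [mul_sub, mul_smul_comm, hV, Units.mul_inv, mul_one, hU, hν, map_add,
      Algebra.algebraMap_eq_smul_one ((t : ℂ) * μ)]
    abel
  rw [spectrum.mem_resolventSet_iff, hfac]
  exact U.isUnit.mul (isUnit_one_sub_of_norm_lt_one hlt)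

/-! ### The numerical radius and the lower bound -/

theorem norm_inner_le_numericalRadius_mul (T : adjointableOperators A H) (x : H) :
    ‖(inner A ((T : H →L[ℂ] H) x) x : A)‖ ≤ numericalRadius T * ‖x‖ ^ 2 := by
  rcases eq_or_ne x 0 with rfl | hx
  · simp
  have hx' : 0 < ‖x‖ := norm_pos_iff.2 hx
  have h : ‖(inner A ((T : H →L[ℂ] H) ((‖x‖⁻¹ : ℂ) • x)) ((‖x‖⁻¹ : ℂ) • x) : A)‖ ≤
      numericalRadius T :=
    le_csSup (bddAbove_numericalRadius T)
      ⟨_, by rw [norm_smul, norm_inv, Complex.norm_real, norm_norm, inv_mul_cancel₀ hx'.ne'], rfl⟩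
  rw [map_smul, CStarModule.inner_smul_left_complex, CStarModule.inner_smul_right_complex,
    norm_smul, norm_smul, norm_star, norm_inv, Complex.norm_real, norm_norm] at h
  calc _ = (‖x‖⁻¹ * (‖x‖⁻¹ * ‖(inner A ((T : H →L[ℂ] H) x) x : A)‖)) * ‖x‖ ^ 2 := by
        field_simp
    _ ≤ _ := by gcongr

theorem numericalRadius_nonneg (T : adjointableOperators A H) : 0 ≤ numericalRadius T :=
  Real.sSup_nonneg (by rintro r ⟨x, -, rfl⟩; exact norm_nonneg _)

/-- Pairing an approximate equation `C y + z ≈ μ y` with `y`: the part of `C` along `y` is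
controlled by the numerical radius of `C`. -/
theorem norm_sub_numericalRadius_mul_norm_le (C : adjointableOperators A H) (μ : ℂ) (y z e : H)
    (h : (C : H →L[ℂ] H) y + z = μ • y + e) :
    (‖μ‖ - numericalRadius C) * ‖y‖ ≤ ‖z‖ + ‖e‖ := by
  rcases eq_or_ne y 0 with rfl | hy
  · simpa using add_nonneg (norm_nonneg z) (norm_nonneg e)
  have hy' : 0 < ‖y‖ := norm_pos_iff.2 hy
  have h₁ : star μ • (inner A y y : A) =
      inner A ((C : H →L[ℂ] H) y) y + inner A z y - inner A e y := by
    rw [← CStarModule.inner_add_left, h, CStarModule.inner_add_left,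
      CStarModule.inner_smul_left_complex, add_sub_cancel_right]
  have h₂ : ‖μ‖ * ‖y‖ ^ 2 = ‖star μ • (inner A y y : A)‖ := by
    rw [norm_smul, norm_star, CStarModule.norm_sq_eq A]
  have h₃ : ‖μ‖ * ‖y‖ ^ 2 ≤ numericalRadius C * ‖y‖ ^ 2 + ‖z‖ * ‖y‖ + ‖e‖ * ‖y‖ := by
    rw [h₂, h₁]
    exact (norm_sub_le _ _).trans (add_le_add ((norm_add_le _ _).trans
      (add_le_add (norm_inner_le_numericalRadius_mul C y) (CStarModule.norm_inner_le (A := A) H)))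
      (CStarModule.norm_inner_le (A := A) H))
  refine le_of_mul_le_mul_right ?_ hy'
  nlinarith

/-- `A₁B₁ + A₂B₂ - μ` is bounded below when the matrix with rows `(|μ| - w(B₁A₁), -‖B₁A₂‖)` and
`(-‖B₂A₁‖, |μ| - w(B₂A₂))` has positive diagonal and positive determinant. -/
theorem exists_pos_forall_mul_norm_le (A₁ A₂ B₁ B₂ : adjointableOperators A H) {μ : ℂ}
    (h₀ : 0 < ‖μ‖) (h₁ : numericalRadius (B₁ * A₁) < ‖μ‖) (h₂ : numericalRadius (B₂ * A₂) < ‖μ‖)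
    (h : ‖B₁ * A₂‖ * ‖B₂ * A₁‖ <
      (‖μ‖ - numericalRadius (B₁ * A₁)) * (‖μ‖ - numericalRadius (B₂ * A₂))) :
    ∃ c > 0, ∀ x : H, c * ‖x‖ ≤
      ‖((A₁ * B₁ + A₂ * B₂ : adjointableOperators A H) : H →L[ℂ] H) x - μ • x‖ := by
  set m₁ := ‖μ‖ - numericalRadius (B₁ * A₁) with hm₁
  set m₂ := ‖μ‖ - numericalRadius (B₂ * A₂) with hm₂
  have hm₁' : 0 < m₁ := sub_pos.2 h₁
  have hm₂' : 0 < m₂ := sub_pos.2 h₂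
  set D := m₁ * m₂ - ‖B₁ * A₂‖ * ‖B₂ * A₁‖ with hD
  have hD' : 0 < D := sub_pos.2 h
  set K := ‖A₁‖ * (m₂ * ‖B₁‖ + ‖B₁ * A₂‖ * ‖B₂‖) +
    ‖A₂‖ * (m₁ * ‖B₂‖ + ‖B₂ * A₁‖ * ‖B₁‖) + D with hK
  have hK' : 0 < K := by positivity
  refine ⟨D * ‖μ‖ / K, by positivity, fun x => ?_⟩
  set e := ((A₁ * B₁ + A₂ * B₂ : adjointableOperators A H) : H →L[ℂ] H) x - μ • x with he
  set y₁ := (B₁ : H →L[ℂ] H) x with hy₁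
  set y₂ := (B₂ : H →L[ℂ] H) x with hy₂
  have hx : (A₁ : H →L[ℂ] H) y₁ + (A₂ : H →L[ℂ] H) y₂ = μ • x + e := by
    rw [he, add_sub_cancel]; rfl
  have le (S : adjointableOperators A H) (z : H) : ‖(S : H →L[ℂ] H) z‖ ≤ ‖S‖ * ‖z‖ :=
    (S : H →L[ℂ] H).le_opNorm z
  have e₁ : m₁ * ‖y₁‖ ≤ ‖B₁ * A₂‖ * ‖y₂‖ + ‖B₁‖ * ‖e‖ := by
    refine (norm_sub_numericalRadius_mul_norm_le (B₁ * A₁) μ y₁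
      (((B₁ * A₂ : adjointableOperators A H) : H →L[ℂ] H) y₂) ((B₁ : H →L[ℂ] H) e) ?_).trans
      (add_le_add (le _ _) (le _ _))
    have := congrArg (B₁ : H →L[ℂ] H) hx
    rwa [map_add, map_add, map_smul] at this
  have e₂ : m₂ * ‖y₂‖ ≤ ‖B₂ * A₁‖ * ‖y₁‖ + ‖B₂‖ * ‖e‖ := by
    refine (norm_sub_numericalRadius_mul_norm_le (B₂ * A₂) μ y₂
      (((B₂ * A₁ : adjointableOperators A H) : H →L[ℂ] H) y₁) ((B₂ : H →L[ℂ] H) e) ?_).trans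
      (add_le_add (le _ _) (le _ _))
    have := congrArg (B₂ : H →L[ℂ] H) hx
    rwa [map_add, map_add, map_smul, add_comm] at this
  have e₃ : ‖μ‖ * ‖x‖ ≤ ‖A₁‖ * ‖y₁‖ + ‖A₂‖ * ‖y₂‖ + ‖e‖ := by
    rw [← norm_smul, eq_sub_of_add_eq hx.symm]
    exact (norm_sub_le _ _).trans (add_le_add_left ((norm_add_le _ _).trans
      (add_le_add (le _ _) (le _ _))) _)
  -- Cramer's rule for the pair of inequalities `e₁`, `e₂`.
  have f₁ : D * ‖y₁‖ ≤ (m₂ * ‖B₁‖ + ‖B₁ * A₂‖ * ‖B₂‖) * ‖e‖ := by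
    have p := mul_le_mul_of_nonneg_left e₁ hm₂'.le
    have q := mul_le_mul_of_nonneg_left e₂ (norm_nonneg (B₁ * A₂))
    rw [hD]; linarith
  have f₂ : D * ‖y₂‖ ≤ (m₁ * ‖B₂‖ + ‖B₂ * A₁‖ * ‖B₁‖) * ‖e‖ := by
    have p := mul_le_mul_of_nonneg_left e₂ hm₁'.le
    have q := mul_le_mul_of_nonneg_left e₁ (norm_nonneg (B₂ * A₁))
    rw [hD]; linarith
  rw [div_mul_eq_mul_div, div_le_iff₀ hK', hK]
  have p := mul_le_mul_of_nonneg_left e₃ hD'.le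
  have q₁ := mul_le_mul_of_nonneg_left f₁ (norm_nonneg A₁)
  have q₂ := mul_le_mul_of_nonneg_left f₂ (norm_nonneg A₂)
  linarith

/-- `(a + d + √((a - d)² + 4 b)) / 2` is the larger root of `(s - a) (s - d) = b`. -/
theorem lt_and_lt_and_lt_mul_of_half_add_sqrt_lt {a d b s : ℝ} (hb : 0 ≤ b)
    (h : (1 / 2) * (a + d + √((a - d) ^ 2 + 4 * b)) < s) :
    a < s ∧ d < s ∧ b < (s - a) * (s - d) := by
  have h₁ : |a - d| ≤ √((a - d) ^ 2 + 4 * b) := Real.abs_le_sqrt (by linarith)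
  have h₂ : √((a - d) ^ 2 + 4 * b) ^ 2 = (a - d) ^ 2 + 4 * b := Real.sq_sqrt (by positivity)
  have h₃ := Real.sqrt_nonneg ((a - d) ^ 2 + 4 * b)
  have h₄ := abs_le.1 h₁
  refine ⟨by linarith, by linarith, ?_⟩
  have h₅ : √((a - d) ^ 2 + 4 * b) ^ 2 < (2 * s - a - d) ^ 2 :=
    pow_lt_pow_left₀ (by linarith) h₃ two_ne_zero
  linarith

end HilbertCStarModule

theorem proposition4p2 {A H : Type*} [NonUnitalCStarAlgebra A] [PartialOrder A]
    [StarOrderedRing A] [NormedAddCommGroup H] [NormedSpace ℂ H] [CompleteSpace H] [SMul A H]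
    [CStarModule A H] (A₁ A₂ B₁ B₂ : adjointableOperators A H) :
    spectralRadius ℂ (A₁ * B₁ + A₂ * B₂) ≤
      ENNReal.ofReal ((1 / 2) * (numericalRadius (B₁ * A₁) + numericalRadius (B₂ * A₂) +
        √((numericalRadius (B₁ * A₁) - numericalRadius (B₂ * A₂)) ^ 2 +
          4 * (‖B₁ * A₂‖ * ‖B₂ * A₁‖)))) := by
  set T := A₁ * B₁ + A₂ * B₂ with hT
  rcases (spectrum ℂ T).eq_empty_or_nonempty with hne | hne
  -- The spectrum is empty exactly when `H = 0`.
  · simp [spectralRadius, hne]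
  obtain ⟨μ, hμ, hμmax⟩ := (spectrum.isCompact (𝕜 := ℂ) T).exists_isMaxOn hne
    continuous_norm.continuousOn
  refine iSup₂_le fun ν hν => ?_
  rw [← enorm_eq_nnnorm, ← ofReal_norm]
  refine ENNReal.ofReal_le_ofReal ((hμmax hν).trans ?_)
  by_contra! hlt
  obtain ⟨h₁, h₂, h⟩ := lt_and_lt_and_lt_mul_of_half_add_sqrt_lt (by positivity) hlt
  have h₀ : 0 < ‖μ‖ := (numericalRadius_nonneg _).trans_lt h₁
  obtain ⟨c, hc, hbdd⟩ := exists_pos_forall_mul_norm_le A₁ A₂ B₁ B₂ h₀ h₁ h₂ h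
  exact hμ (mem_resolventSet_of_forall_mul_norm_le (norm_pos_iff.1 h₀)
    (fun ν hν => hμmax hν) hc hbdd)
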